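/- Let $\mathbb{F}$ be a field of characteristic $0$, let $A$ be an abelian group, let $T$ be a vector space over $\mathbb{F}$, and let $\varphi : T\times A\to\mathbb{F}$ be a map that is $\mathbb{F}$-linear in the first variable and additive in the second. Let $\mathbb{F}A$ be the group algebra of $A$, with basis $t^\alpha$ ($\alpha\in A$) and $t^\alpha t^\beta=t^{\alpha+\beta}$. The generalized Witt algebra $W=W(A,T,\varphi)$ is the Lie algebra with underlying vector space $\mathbb{F}A\otimes_{\mathbb{F}}T$ and bracket $$[t^\alpha\partial,\,t^\beta\delta]=t^{\alpha+\beta}\bigl(\varphi(\partial,\beta)\,\delta-\varphi(\delta,\alpha)\,\partial\bigr),\qquad \alpha,\beta\in A,\ \partial,\delta\in T,$$ where $t^\alpha\partial$ stands for $t^\alpha\otimes\partial$. A local automorphism of a Lie algebra $L$ is a linear map $\Phi:L\to L$ such that for every $x\in L$ there is a Lie algebra automorphism $\theta_x$ of $L$, depending on $x$, with $\Phi(x)=\theta_x(x)$. Suppose that $W$ is a simple Lie algebra. Then every invertible local automorphism $\Phi:W\to W$ is an automorphism of the Lie algebra $W$. -/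

import Mathlib

open scoped TensorProduct

noncomputable section

/-- A linear endomorphism `Φ` of a Lie algebra `L` is a local automorphism if for every `x` there
is an automorphism `θ` of the Lie algebra `L`, depending on `x`, with `Φ x = θ x`. -/
def IsLocalLieAutomorphism {F L : Type*} [CommRing F] [LieRing L] [LieAlgebra F L]
    (Φ : L →ₗ[F] L) : Prop :=
  ∀ x : L, ∃ θ : L ≃ₗ⁅F⁆ L, Φ x = θ x

/-- The underlying space `F A ⊗ T` of the generalized Witt algebra `W(A, T, φ)`, where `F A` is the
group algebra and `φ : T × A → F` is linear in the first and additive in the second variable. -/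
def GenWitt {F A T : Type*} [Field F] [AddCommGroup A] [AddCommGroup T] [Module F T]
    (_φ : T →ₗ[F] A →+ F) : Type _ :=
  AddMonoidAlgebra F A ⊗[F] T

namespace GenWitt

section

variable {F A T : Type*} [Field F] [AddCommGroup A] [AddCommGroup T] [Module F T]
variable (φ : T →ₗ[F] A →+ F)

instance instAddCommGroup : AddCommGroup (GenWitt φ) :=
  inferInstanceAs (AddCommGroup (AddMonoidAlgebra F A ⊗[F] T))

instance instModule : Module F (GenWitt φ) :=
  inferInstanceAs (Module F (AddMonoidAlgebra F A ⊗[F] T))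

/-- The pure tensor `f ⊗ ∂`, for `f` in the group algebra and `∂ ∈ T`. -/
def tmul (f : AddMonoidAlgebra F A) (d : T) : GenWitt φ := f ⊗ₜ[F] d

/-- The homogeneous element `t^α ∂ = t^α ⊗ ∂`. -/
def mono (α : A) (d : T) : GenWitt φ := tmul φ (AddMonoidAlgebra.single α 1) d

/-- The operator `t^α ↦ φ(∂, α) t^α` on the group algebra, depending linearly on `∂ ∈ T`. -/
def der : T →ₗ[F] Module.End F (AddMonoidAlgebra F A) where
  toFun d := (Finsupp.lsum F fun α : A => φ d α • AddMonoidAlgebra.lsingle α) ∘ₗ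
    (AddMonoidAlgebra.coeffLinearEquiv F).toLinearMap
  map_add' d e := by
    ext α : 2
    simp [add_smul]
  map_smul' c d := by
    ext α : 2
    simp [mul_smul]

theorem der_single (d : T) (α : A) (c : F) :
    der φ d (AddMonoidAlgebra.single α c) = φ d α • AddMonoidAlgebra.single α c := by
  simp [der]

theorem der_mul (d : T) (f g : AddMonoidAlgebra F A) :
    der φ d (f * g) = der φ d f * g + f * der φ d g := by
  induction f using AddMonoidAlgebra.induction_linear with
  | zero => simp
  | add f₁ f₂ h₁ h₂ => rw [add_mul, map_add, h₁, h₂, map_add]; ring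
  | single α a =>
    induction g using AddMonoidAlgebra.induction_linear with
    | zero => simp
    | add g₁ g₂ h₁ h₂ => rw [mul_add, map_add, h₁, h₂, map_add]; ring
    | single β b =>
      simp only [AddMonoidAlgebra.single_mul_single, der_single, map_add, add_smul,
        smul_mul_assoc, mul_smul_comm]

theorem der_comm (d e : T) (f : AddMonoidAlgebra F A) :
    der φ d (der φ e f) = der φ e (der φ d f) := by
  induction f using AddMonoidAlgebra.induction_linear with
  | zero => simp
  | add f₁ f₂ h₁ h₂ => simp only [map_add, h₁, h₂]
  | single α a => simp only [der_single, map_smul]; rw [smul_comm]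

/-- The action of `F A ⊗ T` on the group algebra, `(f ∂) g = f ∂(g)`. -/
def act : GenWitt φ →ₗ[F] Module.End F (AddMonoidAlgebra F A) :=
  TensorProduct.lift (LinearMap.mk₂ F (fun f d => LinearMap.mulLeft F f ∘ₗ der φ d)
    (fun f g d => by ext; simp [add_mul])
    (fun c f d => by ext; simp)
    (fun f d e => by ext; simp [mul_add])
    (fun c f d => by ext; simp))

theorem act_tmul (f g : AddMonoidAlgebra F A) (d : T) :
    act φ (tmul φ f d) g = f * der φ d g := rfl

/-- The bilinear product `(f ∂) · (g δ) = f ∂(g) δ` on `F A ⊗ T`. -/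
def prod : GenWitt φ →ₗ[F] GenWitt φ →ₗ[F] GenWitt φ :=
  (LinearMap.rTensorHom T : _ →ₗ[F] Module.End F (AddMonoidAlgebra F A ⊗[F] T)) ∘ₗ act φ

theorem prod_tmul (X : GenWitt φ) (g : AddMonoidAlgebra F A) (e : T) :
    prod φ X (tmul φ g e) = tmul φ (act φ X g) e := rfl

/-- The bracket of `W(A, T, φ)`: `[f ∂, g δ] = f ∂(g) δ - g δ(f) ∂`. -/
instance instBracket : Bracket (GenWitt φ) (GenWitt φ) :=
  ⟨fun X Y => prod φ X Y - prod φ Y X⟩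

theorem bracket_def (X Y : GenWitt φ) : ⁅X, Y⁆ = prod φ X Y - prod φ Y X := rfl

theorem tmul_add (f : AddMonoidAlgebra F A) (d e : T) :
    tmul φ f (d + e) = tmul φ f d + tmul φ f e := TensorProduct.tmul_add f d e

theorem sub_tmul (f g : AddMonoidAlgebra F A) (d : T) :
    tmul φ (f - g) d = tmul φ f d - tmul φ g d := TensorProduct.sub_tmul f g d

@[elab_as_elim]
theorem induction_on {P : GenWitt φ → Prop} (X : GenWitt φ) (zero : P 0)
    (tmul : ∀ f d, P (tmul φ f d)) (add : ∀ X Y, P X → P Y → P (X + Y)) : P X :=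
  TensorProduct.induction_on (motive := P) X zero tmul add

theorem act_bracket (X Y : GenWitt φ) (h : AddMonoidAlgebra F A) :
    act φ ⁅X, Y⁆ h = act φ X (act φ Y h) - act φ Y (act φ X h) := by
  rw [bracket_def]
  induction X using induction_on with
  | zero => simp
  | add X₁ X₂ h₁ h₂ =>
    simp only [map_add, map_sub, LinearMap.add_apply, LinearMap.sub_apply] at h₁ h₂ ⊢
    rw [add_sub_add_comm, h₁, h₂]; abel
  | tmul f d =>
    induction Y using induction_on with
    | zero => simp
    | add Y₁ Y₂ h₁ h₂ =>
      simp only [map_add, map_sub, LinearMap.add_apply, LinearMap.sub_apply] at h₁ h₂ ⊢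
      rw [add_sub_add_comm, h₁, h₂]; abel
    | tmul g e =>
      simp only [map_sub, LinearMap.sub_apply, prod_tmul, act_tmul, der_mul, der_comm φ e d]
      ring

theorem prod_bracket (X Y Z : GenWitt φ) :
    prod φ ⁅X, Y⁆ Z = prod φ X (prod φ Y Z) - prod φ Y (prod φ X Z) := by
  induction Z using induction_on with
  | zero => simp
  | add Z₁ Z₂ h₁ h₂ => simp only [map_add, h₁, h₂]; abel
  | tmul g e => simp only [prod_tmul, act_bracket, sub_tmul]

instance instLieRing : LieRing (GenWitt φ) where
  add_lie X Y Z := by simp only [bracket_def, map_add, LinearMap.add_apply]; abel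
  lie_add X Y Z := by simp only [bracket_def, map_add, LinearMap.add_apply]; abel
  lie_self X := by rw [bracket_def, sub_self]
  leibniz_lie X Y Z := by
    rw [bracket_def φ X ⁅Y, Z⁆, bracket_def φ ⁅X, Y⁆ Z, bracket_def φ Y ⁅X, Z⁆,
      prod_bracket, prod_bracket, prod_bracket]
    simp only [bracket_def, map_sub]
    abel

instance instLieAlgebra : LieAlgebra F (GenWitt φ) where
  lie_smul c X Y := by
    simp only [bracket_def, map_smul, LinearMap.smul_apply, smul_sub]

/-- The defining formula `[t^α ∂, t^β δ] = t^(α + β) (φ(∂, β) δ - φ(δ, α) ∂)`. -/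
theorem mono_bracket (α β : A) (d e : T) :
    ⁅mono φ α d, mono φ β e⁆ = mono φ (α + β) (φ d β • e - φ e α • d) := by
  have h (α β : A) (d e : T) :
      prod φ (mono φ α d) (mono φ β e) = φ d β • mono φ (α + β) e := by
    simp only [mono, prod_tmul, act_tmul, der_single, mul_smul_comm,
      AddMonoidAlgebra.single_mul_single, mul_one]
    rfl
  rw [bracket_def, h, h, add_comm β α]
  simp only [mono, tmul, TensorProduct.tmul_sub, TensorProduct.tmul_smul]
  rfl

end

end GenWitt

end

/-! Simplicity makes `φ` nondegenerate on both sides: the kernel of the action on the group algebra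
is an abelian ideal, and a degree α paired to zero with all of T gives the ideal (t^α - 1)W, which
is proper and vanishes only for α = 0. Hence A embeds in the ℚ-vector space of functions T → F and
can be linearly ordered.

Looking at leading terms for this order, the locally finite elements are exactly those of the torus
t^0 T. Automorphisms therefore preserve the torus and permute its weight spaces, which leads to the
form t^α ∂ ↦ χ(α) t^(s α) τ(∂) with φ(τ ∂, s α) = φ(∂, α) (`exists_automorphism_form`).

Testing a local automorphism on t^0 d + t^α e gives it the same form, with scalars c(α) not yet
known to be multiplicative (`exists_form_of_local`). Now choose d separating the points of a finite
set S of degrees containing 0. An automorphism agreeing with Φ at the sum of the t^γ d, γ ∈ S, must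
carry the same scalars c on S (`exists_automorphism_eq_on`). With S = {0, α, β, α + β} this makes c
multiplicative wherever the bracket does not vanish. -/

noncomputable section

namespace GenWitt

variable {F A T : Type*} [Field F] [AddCommGroup A] [AddCommGroup T] [Module F T]
variable {φ : T →ₗ[F] A →+ F}

/-! ### Homogeneous components -/

open scoped Classical in
variable (φ) in
/-- The homogeneous components of an element of `W(A, T, φ)`. -/
def coeffs : GenWitt φ ≃ₗ[F] A →₀ T :=
  (TensorProduct.congr (AddMonoidAlgebra.coeffLinearEquiv F) (LinearEquiv.refl F T)).trans
    (TensorProduct.finsuppScalarLeft F T A)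

variable (φ) in
/-- The map `∂ ↦ t^α ∂` as a linear map. -/
def monoHom (α : A) : T →ₗ[F] GenWitt φ :=
  TensorProduct.mk F (AddMonoidAlgebra F A) T (AddMonoidAlgebra.single α 1)

theorem mono_smul (α : A) (c : F) (d : T) : mono φ α (c • d) = c • mono φ α d :=
  map_smul (monoHom φ α) c d

theorem mono_zero (α : A) : mono φ α (0 : T) = 0 := map_zero (monoHom φ α)

theorem coeffs_mono (α : A) (d : T) : coeffs φ (mono φ α d) = Finsupp.single α d := by
  classical
  change TensorProduct.finsuppScalarLeft F T A (Finsupp.single α 1 ⊗ₜ d) = _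
  rw [TensorProduct.finsuppScalarLeft_apply_tmul, Finsupp.sum_single_index (by simp), one_smul]

@[simp] theorem coeffs_mono_self (α : A) (d : T) : coeffs φ (mono φ α d) α = d := by
  rw [coeffs_mono, Finsupp.single_eq_same]

theorem coeffs_mono_of_ne {α β : A} (h : β ≠ α) (d : T) : coeffs φ (mono φ α d) β = 0 := by
  rw [coeffs_mono, Finsupp.single_eq_of_ne h]

theorem ext_coeffs {X Y : GenWitt φ} (h : ∀ α, coeffs φ X α = coeffs φ Y α) : X = Y :=
  (coeffs φ).injective (Finsupp.ext h)

theorem mono_eq_zero {α : A} {d : T} : mono φ α d = 0 ↔ d = 0 := by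
  refine ⟨fun h => ?_, fun h => by rw [h, mono_zero]⟩
  rw [← coeffs_mono_self (φ := φ) α d, h, map_zero, Finsupp.zero_apply]

theorem mono_left_injective {α β : A} {d e : T} (hd : d ≠ 0)
    (h : mono φ α d = mono φ β e) : α = β := by
  by_contra hne
  apply hd
  rw [← coeffs_mono_self (φ := φ) α d, h, coeffs_mono_of_ne hne]

theorem mono_right_injective {α : A} {d e : T} (h : mono φ α d = mono φ α e) : d = e := by
  rw [← coeffs_mono_self (φ := φ) α d, h, coeffs_mono_self]

theorem eq_sum_mono (X : GenWitt φ) : X = (coeffs φ X).sum fun α d => mono φ α d := by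
  apply (coeffs φ).injective
  simp only [Finsupp.sum, map_sum, coeffs_mono]
  exact (Finsupp.sum_single _).symm

@[elab_as_elim]
theorem mono_induction {P : GenWitt φ → Prop} (X : GenWitt φ) (zero : P 0)
    (mono : ∀ α d, P (mono φ α d)) (add : ∀ X Y, P X → P Y → P (X + Y)) : P X := by
  rw [eq_sum_mono X]
  exact Finset.sum_induction _ P add zero fun α _ => mono α _

/-- A homogeneous element of degree `α` shifts homogeneous components by `α`. -/
theorem coeffs_mono_lie (α : A) (d : T) (Y : GenWitt φ) (γ : A) :
    coeffs φ ⁅mono φ α d, Y⁆ γ =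
      φ d (γ - α) • coeffs φ Y (γ - α) - φ (coeffs φ Y (γ - α)) α • d := by
  induction Y using mono_induction with
  | zero => simp
  | add X Y hX hY =>
    rw [lie_add, map_add, Finsupp.add_apply, hX, hY]
    simp only [map_add, Finsupp.add_apply, smul_add, AddMonoidHom.add_apply, add_smul]
    abel
  | mono β e =>
    rw [mono_bracket]
    by_cases h : γ - α = β
    · obtain rfl : γ = α + β := by rw [← h]; abel
      rw [h, coeffs_mono_self, coeffs_mono_self]
    · rw [coeffs_mono_of_ne h, coeffs_mono_of_ne (fun h' => h (by rw [h']; abel))]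
      simp

theorem coeffs_lie (X Y : GenWitt φ) (γ : A) :
    coeffs φ ⁅X, Y⁆ γ = ∑ α ∈ (coeffs φ X).support,
      (φ (coeffs φ X α) (γ - α) • coeffs φ Y (γ - α) -
        φ (coeffs φ Y (γ - α)) α • coeffs φ X α) := by
  conv_lhs => rw [eq_sum_mono X]
  simp only [Finsupp.sum, sum_lie, map_sum, Finsupp.finsetSum_apply, coeffs_mono_lie]

/-- An element on which every `∂ ∈ T` acts by `φ(∂, α)` is homogeneous of degree `α`. -/
theorem eq_mono_of_weight (hr : ∀ α : A, (∀ d, φ d α = 0) → α = 0) {α : A} {Y : GenWitt φ}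
    (h : ∀ d, ⁅mono φ 0 d, Y⁆ = φ d α • Y) : Y = mono φ α (coeffs φ Y α) := by
  refine ext_coeffs fun γ => ?_
  by_cases hγ : γ = α
  · rw [hγ, coeffs_mono_self]
  rw [coeffs_mono_of_ne hγ]
  by_contra hY
  refine hγ (sub_eq_zero.mp (hr _ fun d => ?_))
  have := congrArg (fun Z => coeffs φ Z γ) (h d)
  simp only [coeffs_mono_lie, sub_zero, map_zero, zero_smul, map_smul, Finsupp.smul_apply] at this
  rw [map_sub, sub_eq_zero]
  exact smul_left_injective F hY this

/-! ### Nondegeneracy of the pairing -/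

/-- The ideal of elements acting trivially on the group algebra. -/
def actKer (φ : T →ₗ[F] A →+ F) : LieIdeal F (GenWitt φ) where
  __ := LinearMap.ker (act φ)
  lie_mem := by
    intro X Y hY
    have hY : act φ Y = 0 := hY
    change act φ ⁅X, Y⁆ = 0
    refine LinearMap.ext fun h => ?_
    rw [act_bracket, hY]
    simp

/-- The product X · Y depends on X only through its action on the group algebra. -/
theorem lie_eq_zero_of_act_eq_zero {X Y : GenWitt φ} (hX : act φ X = 0) (hY : act φ Y = 0) :
    ⁅X, Y⁆ = 0 := by
  have h {X : GenWitt φ} (hX : act φ X = 0) (Y : GenWitt φ) : prod φ X Y = 0 := by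
    induction Y using induction_on with
    | zero => exact map_zero _
    | add Y Y' h h' => rw [map_add, h, h', add_zero]
    | tmul g e =>
      rw [prod_tmul, hX]
      exact TensorProduct.zero_tmul _ _
  rw [bracket_def, h hX, h hY, sub_zero]

theorem act_injective (hs : LieAlgebra.IsSimple F (GenWitt φ)) {X : GenWitt φ}
    (hX : act φ X = 0) : X = 0 := by
  rcases hs.eq_bot_or_eq_top (actKer φ) with h | h
  · exact (LieSubmodule.mem_bot X).mp (h ▸ (show X ∈ actKer φ from hX))
  · refine absurd ⟨fun Y Z => ?_⟩ hs.non_abelian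
    have hm (Y : GenWitt φ) : Y ∈ actKer φ := h ▸ LieSubmodule.mem_top Y
    exact lie_eq_zero_of_act_eq_zero (hm Y) (hm Z)

theorem left_nondegenerate (hs : LieAlgebra.IsSimple F (GenWitt φ)) (d : T)
    (hd : ∀ α, φ d α = 0) : d = 0 := by
  refine mono_eq_zero.mp (act_injective hs (X := mono φ 0 d) ?_)
  refine AddMonoidAlgebra.lhom_ext' fun α => LinearMap.ext fun c => ?_
  simp [mono, act_tmul, der_single, hd]

theorem exists_ne_zero (hs : LieAlgebra.IsSimple F (GenWitt φ)) : ∃ d : T, d ≠ 0 := by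
  by_contra! h
  refine hs.non_abelian ⟨fun X Y => ext_coeffs fun α => ?_⟩
  rw [h (coeffs φ ⁅X, Y⁆ α), map_zero, Finsupp.zero_apply]

variable (φ) in
/-- Multiplication by `t^α - 1`. -/
def shiftSub (α : A) : GenWitt φ →ₗ[F] GenWitt φ :=
  (coeffs φ).symm.toLinearMap ∘ₗ
    (Finsupp.lmapDomain T F (α + ·) - LinearMap.id) ∘ₗ (coeffs φ).toLinearMap

theorem shiftSub_mono (α β : A) (d : T) :
    shiftSub φ α (mono φ β d) = mono φ (α + β) d - mono φ β d := by
  apply (coeffs φ).injective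
  simp [shiftSub, coeffs_mono, Finsupp.mapDomain_single]

/-- No ∂ sees the degree α, so t^α behaves as a constant for the bracket. -/
theorem lie_shiftSub {α : A} (hα : ∀ d, φ d α = 0) (Y X : GenWitt φ) :
    ⁅Y, shiftSub φ α X⁆ = shiftSub φ α ⁅Y, X⁆ := by
  induction X using mono_induction with
  | zero => simp
  | add X X' h h' => simp only [map_add, lie_add, h, h']
  | mono γ d =>
    induction Y using mono_induction with
    | zero => simp
    | add X X' h h' => simp only [map_add, add_lie, h, h']
    | mono β e =>
      rw [shiftSub_mono, lie_sub, mono_bracket, mono_bracket, shiftSub_mono, map_add, hα, zero_add,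
        add_left_comm]

/-- The ideal `(t^α - 1) W`, for `α` in the right kernel of the pairing. -/
def shiftIdeal {α : A} (hα : ∀ d, φ d α = 0) : LieIdeal F (GenWitt φ) where
  __ := LinearMap.range (shiftSub φ α)
  lie_mem := by
    rintro X _ ⟨Y, rfl⟩
    exact ⟨⁅X, Y⁆, (lie_shiftSub hα X Y).symm⟩

variable (φ) in
/-- The sum of the homogeneous components. -/
def coeffSum : GenWitt φ →ₗ[F] T :=
  Finsupp.lsum F (fun _ : A => LinearMap.id) ∘ₗ (coeffs φ).toLinearMap

theorem coeffSum_mono (α : A) (d : T) : coeffSum φ (mono φ α d) = d := by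
  simp [coeffSum, coeffs_mono]

theorem coeffSum_shiftSub (α : A) (X : GenWitt φ) : coeffSum φ (shiftSub φ α X) = 0 := by
  induction X using mono_induction with
  | zero => simp
  | add X X' h h' => simp only [map_add, h, h', add_zero]
  | mono γ d => rw [shiftSub_mono, map_sub, coeffSum_mono, coeffSum_mono, sub_self]

/-- The ideal (t^α - 1)W is not everything, since the sum of components vanishes on it; so it is
zero, and the shift by α fixes t^0 d. -/
theorem right_nondegenerate (hs : LieAlgebra.IsSimple F (GenWitt φ)) (α : A)
    (hα : ∀ d, φ d α = 0) : α = 0 := by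
  obtain ⟨d, hd⟩ := exists_ne_zero hs
  rcases hs.eq_bot_or_eq_top (shiftIdeal hα) with h | h
  · have h0 : shiftSub φ α (mono φ 0 d) = 0 :=
      (LieSubmodule.mem_bot _).mp (h ▸ (show _ ∈ shiftIdeal hα from ⟨_, rfl⟩))
    rw [shiftSub_mono, add_zero, sub_eq_zero] at h0
    exact mono_left_injective hd h0
  · obtain ⟨X, hX⟩ : mono φ 0 d ∈ shiftIdeal hα := h ▸ LieSubmodule.mem_top _
    refine absurd ?_ hd
    rw [← coeffSum_mono (φ := φ) 0 d, ← coeffSum_shiftSub α X]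
    exact congrArg _ hX.symm

/-! ### Locally finite elements -/

/-- `X` is locally finite if every element lies in a finite-dimensional subspace stable under
`ad X`. -/
def IsLocallyFinite {F L : Type*} [Field F] [LieRing L] [LieAlgebra F L] (X : L) : Prop :=
  ∀ Y : L, ∃ N : Submodule F L, N.FG ∧ Y ∈ N ∧ ∀ Z ∈ N, ⁅X, Z⁆ ∈ N

theorem IsLocallyFinite.map {F L : Type*} [Field F] [LieRing L] [LieAlgebra F L] {X : L}
    (h : IsLocallyFinite (F := F) X) (θ : L ≃ₗ⁅F⁆ L) : IsLocallyFinite (F := F) (θ X) := by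
  intro Y
  obtain ⟨N, hN, hY, hX⟩ := h (θ.symm Y)
  refine ⟨N.map (θ : L →ₗ[F] L), hN.map _, ⟨_, hY, θ.apply_symm_apply Y⟩, ?_⟩
  rintro _ ⟨Z, hZ, rfl⟩
  exact ⟨_, hX Z hZ, LieEquiv.map_lie θ X Z⟩

theorem mono_zero_lie_mono (d : T) (γ : A) (e : T) :
    ⁅mono φ 0 d, mono φ γ e⁆ = φ d γ • mono φ γ e := by
  rw [mono_bracket, map_zero, zero_smul, sub_zero, zero_add, mono_smul]

theorem isLocallyFinite_mono_zero (d : T) : IsLocallyFinite (F := F) (mono φ 0 d) := by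
  intro Y
  refine ⟨Submodule.span F ((fun γ => mono φ γ (coeffs φ Y γ)) '' (coeffs φ Y).support),
    Submodule.fg_span ((Finset.finite_toSet _).image _), ?_, fun Z hZ => ?_⟩
  · have h : ((coeffs φ Y).sum fun γ d => mono φ γ d) ∈
        Submodule.span F ((fun γ => mono φ γ (coeffs φ Y γ)) '' (coeffs φ Y).support) :=
      Submodule.sum_mem _ fun γ hγ => Submodule.subset_span
        (Set.mem_image_of_mem (fun γ => mono φ γ (coeffs φ Y γ)) (Finset.mem_coe.mpr hγ))
    rwa [← eq_sum_mono] at h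
  · induction hZ using Submodule.span_induction with
    | zero => rw [lie_zero]; exact Submodule.zero_mem _
    | add X Y _ _ hX hY => rw [lie_add]; exact Submodule.add_mem _ hX hY
    | smul c X _ hX => rw [lie_smul]; exact Submodule.smul_mem _ c hX
    | mem X hX =>
      obtain ⟨γ, hγ, rfl⟩ := hX
      simp only [mono_zero_lie_mono]
      exact Submodule.smul_mem _ _ (Submodule.subset_span ⟨γ, hγ, rfl⟩)

theorem exists_support_subset {N : Submodule F (GenWitt φ)} (hN : N.FG) :
    ∃ S : Finset A, ∀ Z ∈ N, ∀ γ, coeffs φ Z γ ≠ 0 → γ ∈ S := by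
  classical
  obtain ⟨s, rfl⟩ := hN
  refine ⟨s.biUnion fun Z => (coeffs φ Z).support, fun Z hZ γ => ?_⟩
  contrapose!
  intro hγ
  induction hZ using Submodule.span_induction with
  | zero => simp
  | add X Y _ _ hX hY => rw [map_add, Finsupp.add_apply, hX, hY, add_zero]
  | smul c X _ hX => rw [map_smul, Finsupp.smul_apply, hX, smul_zero]
  | mem X hX =>
    by_contra h
    exact hγ (Finset.mem_biUnion.mpr ⟨X, hX, Finsupp.mem_support_iff.mpr h⟩)

section Order

variable {K : Type*} [AddCommGroup K] [LinearOrder K] [IsOrderedAddMonoid K]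

/-- The leading component of a bracket, with respect to an order on the degrees. -/
theorem coeffs_lie_leading {f : A →+ K} (hf : Function.Injective f) {X Y : GenWitt φ} {α β : A}
    (hX : ∀ γ, coeffs φ X γ ≠ 0 → f γ ≤ f α) (hY : ∀ γ, coeffs φ Y γ ≠ 0 → f γ ≤ f β) :
    (∀ γ, coeffs φ ⁅X, Y⁆ γ ≠ 0 → f γ ≤ f (α + β)) ∧
      coeffs φ ⁅X, Y⁆ (α + β) =
        φ (coeffs φ X α) β • coeffs φ Y β - φ (coeffs φ Y β) α • coeffs φ X α := by
  constructor
  · intro γ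
    contrapose!
    intro hγ
    rw [coeffs_lie]
    refine Finset.sum_eq_zero fun α' hα' => ?_
    have h1 := hX α' (Finsupp.mem_support_iff.mp hα')
    have : coeffs φ Y (γ - α') = 0 := by
      by_contra h
      have h2 := hY _ h
      rw [map_sub, sub_le_iff_le_add'] at h2
      rw [map_add] at hγ
      exact absurd (h2.trans (add_le_add_left h1 _)) (not_le.mpr hγ)
    rw [this]
    simp
  · rw [coeffs_lie, Finset.sum_eq_single α]
    · rw [add_sub_cancel_left]
    · intro α' hα' hne
      have h1 := hX α' (Finsupp.mem_support_iff.mp hα')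
      have : coeffs φ Y (α + β - α') = 0 := by
        by_contra h
        have h2 := hY _ h
        rw [map_sub, map_add, sub_le_iff_le_add', add_le_add_iff_right] at h2
        exact hne (hf (le_antisymm h1 h2))
      rw [this]
      simp
    · intro h
      rw [Finsupp.notMem_support_iff.mp h]
      simp

/-- Iterating ad X on a suitable t^β e, with e the leading component of X, gives nonzero leading
terms in the infinitely many degrees kα + β. -/
theorem not_isLocallyFinite_of_pos [CharZero F] (hl : ∀ d : T, (∀ α, φ d α = 0) → d = 0)
    {f : A →+ K} (hf : Function.Injective f) {X : GenWitt φ} {α : A}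
    (hα : coeffs φ X α ≠ 0) (hX : ∀ γ, coeffs φ X γ ≠ 0 → f γ ≤ f α) (hpos : 0 < f α) :
    ¬ IsLocallyFinite (F := F) X := by
  intro hfin
  set e := coeffs φ X α with he
  -- The k-th bracket multiplies the leading term by φ(e, kα + β) - φ(e, α). If φ(e, α) ≠ 0, then β
  -- = 2α turns this into (k + 1) φ(e, α).
  obtain ⟨β, hβ⟩ : ∃ β, ∀ k : ℕ, φ e β + ((k : F) - 1) * φ e α ≠ 0 := by
    by_cases h : φ e α = 0
    · obtain ⟨β, hβ⟩ : ∃ β, φ e β ≠ 0 := by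
        by_contra! h'
        exact hα (hl e h')
      exact ⟨β, fun k => by rwa [h, mul_zero, add_zero]⟩
    · refine ⟨α + α, fun k => ?_⟩
      rw [map_add, show φ e α + φ e α + ((k : F) - 1) * φ e α = ((k + 1 : ℕ) : F) * φ e α by
        push_cast; ring]
      exact mul_ne_zero (Nat.cast_ne_zero.mpr k.succ_ne_zero) h
  obtain ⟨N, hN, hY, hstable⟩ := hfin (mono φ β e)
  obtain ⟨S, hS⟩ := exists_support_subset hN
  have key (k : ℕ) : ∃ Z ∈ N, ∃ c : F, c ≠ 0 ∧ coeffs φ Z (k • α + β) = c • e ∧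
      ∀ γ, coeffs φ Z γ ≠ 0 → f γ ≤ f (k • α + β) := by
    induction k with
    | zero =>
      refine ⟨_, hY, 1, one_ne_zero, by simp, fun γ hγ => ?_⟩
      by_cases h : γ = β
      · simp [h]
      · exact absurd (coeffs_mono_of_ne h e) hγ
    | succ k ih =>
      obtain ⟨Z, hZ, c, hc, hZc, hZf⟩ := ih
      obtain ⟨h1, h2⟩ := coeffs_lie_leading hf hX hZf
      rw [← add_assoc, ← succ_nsmul'] at h1 h2
      refine ⟨⁅X, Z⁆, hstable Z hZ, c * (φ e β + ((k : F) - 1) * φ e α),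
        mul_ne_zero hc (hβ k), ?_, h1⟩
      rw [h2, hZc, ← he, smul_smul, ← sub_smul]
      congr 1
      simp only [map_add, map_nsmul, map_smul, AddMonoidHom.smul_apply, smul_eq_mul, nsmul_eq_mul]
      ring
  have hinj : Function.Injective fun k : ℕ => k • α + β := by
    intro k l h
    have h : k • f α = l • f α := by
      rw [← map_nsmul, ← map_nsmul, add_right_cancel h]
    exact (nsmul_left_strictMono hpos).injective h
  refine Set.infinite_range_of_injective hinj (S.finite_toSet.subset ?_)
  rintro _ ⟨k, rfl⟩
  obtain ⟨Z, hZ, c, hc, hZc, -⟩ := key k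
  exact hS Z hZ _ (hZc ▸ smul_ne_zero hc hα)

/-- The locally finite elements are homogeneous of degree `0`. -/
theorem IsLocallyFinite.eq_mono [CharZero F] (hl : ∀ d : T, (∀ α, φ d α = 0) → d = 0)
    {f : A →+ K} (hf : Function.Injective f) {X : GenWitt φ}
    (hX : IsLocallyFinite (F := F) X) : X = mono φ 0 (coeffs φ X 0) := by
  have main (f : A →+ K) (hf : Function.Injective f) (γ : A) (hγ : coeffs φ X γ ≠ 0) :
      f γ ≤ 0 := by
    obtain ⟨α, hα, hmax⟩ := (coeffs φ X).support.exists_max_image f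
      ⟨γ, Finsupp.mem_support_iff.mpr hγ⟩
    refine (hmax γ (Finsupp.mem_support_iff.mpr hγ)).trans (not_lt.mp fun hpos => ?_)
    exact not_isLocallyFinite_of_pos hl hf (Finsupp.mem_support_iff.mp hα)
      (fun γ hγ => hmax γ (Finsupp.mem_support_iff.mpr hγ)) hpos hX
  refine ext_coeffs fun γ => ?_
  by_cases hγ : γ = 0
  · rw [hγ, coeffs_mono_self]
  rw [coeffs_mono_of_ne hγ]
  by_contra h
  refine hγ (hf (le_antisymm ((main f hf γ h).trans_eq (map_zero f).symm) ?_))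
  -- Reversing the order excludes negative degrees.
  have := main (-f) (fun a b hab => hf (neg_injective hab)) γ h
  rwa [map_zero, ← neg_nonpos]

end Order

universe v in
/-- A group embedding into a `ℚ`-vector space embeds into a linearly ordered group. -/
theorem exists_injective_linearOrdered {A : Type*} {V : Type v} [AddCommGroup A] [AddCommGroup V]
    [Module ℚ V] (g : A →+ V) (hg : Function.Injective g) :
    ∃ (ι : Type v) (_ : LinearOrder ι) (f : A →+ Lex (ι →₀ ℚ)), Function.Injective f := by
  let b := Module.Basis.ofVectorSpace ℚ V
  let _ : LinearOrder (Module.Basis.ofVectorSpaceIndex ℚ V) :=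
    @linearOrderOfSTO _ WellOrderingRel inferInstance (Classical.decRel _)
  refine ⟨Module.Basis.ofVectorSpaceIndex ℚ V, inferInstance,
    { toFun := fun a => toLex (b.repr (g a))
      map_zero' := by simp
      map_add' := fun x y => by simp }, fun x y h => hg (b.repr.injective (toLex.injective h))⟩

variable (φ) in
/-- The pairing as a map from `A` to the functions on `T`. -/
def pairingHom : A →+ T → F where
  toFun α d := φ d α
  map_zero' := by ext; simp
  map_add' α β := by ext; simp

theorem eq_mono_zero_of_isLocallyFinite [CharZero F] (hl : ∀ d : T, (∀ α, φ d α = 0) → d = 0)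
    (hr : ∀ α : A, (∀ d, φ d α = 0) → α = 0) {X : GenWitt φ}
    (hX : IsLocallyFinite (F := F) X) : X = mono φ 0 (coeffs φ X 0) := by
  let _ : Module ℚ F := inferInstance
  obtain ⟨ι, _, f, hf⟩ := exists_injective_linearOrdered (pairingHom φ)
    ((injective_iff_map_eq_zero _).mpr fun α h => hr α fun d => congrFun h d)
  exact hX.eq_mono hl hf

/-! ### Automorphisms -/

/-- Automorphisms map homogeneous elements to homogeneous elements. -/
theorem exists_degree_map [CharZero F] (hs : LieAlgebra.IsSimple F (GenWitt φ))
    (θ : GenWitt φ ≃ₗ⁅F⁆ GenWitt φ) :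
    ∃ (s : A → A) (τ : A → T →ₗ[F] T), (∀ α d, θ (mono φ α d) = mono φ (s α) (τ α d)) ∧
      (∀ α d, φ (τ 0 d) (s α) = φ d α) ∧ s 0 = 0 ∧ Function.Bijective (τ 0) := by
  have hl := left_nondegenerate hs
  have hr := right_nondegenerate hs
  have hzero (θ : GenWitt φ ≃ₗ⁅F⁆ GenWitt φ) (d : T) :
      θ (mono φ 0 d) = mono φ 0 (coeffs φ (θ (mono φ 0 d)) 0) :=
    eq_mono_zero_of_isLocallyFinite hl hr ((isLocallyFinite_mono_zero d).map θ)
  let τ (s : A → A) (α : A) : T →ₗ[F] T :=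
    Finsupp.lapply (s α) ∘ₗ (coeffs φ).toLinearMap ∘ₗ (θ : GenWitt φ →ₗ[F] GenWitt φ) ∘ₗ
      monoHom φ α
  have hdeg (α : A) : ∃ γ, ∀ d, φ (coeffs φ (θ (mono φ 0 d)) 0) γ = φ d α := by
    obtain ⟨e, he⟩ := exists_ne_zero hs
    have hne : θ (mono φ α e) ≠ 0 := fun h =>
      he (mono_eq_zero.mp ((map_eq_zero_iff θ θ.injective).mp h))
    obtain ⟨γ, hγ⟩ : ∃ γ, coeffs φ (θ (mono φ α e)) γ ≠ 0 := by
      by_contra! h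
      exact hne (ext_coeffs fun γ => by rw [h, map_zero, Finsupp.zero_apply])
    -- Any degree γ in the support works: compare the eigenvalues of the torus before and after `θ`.
    refine ⟨γ, fun d => smul_left_injective F hγ ?_⟩
    have h := congrArg θ (mono_zero_lie_mono (φ := φ) d α e)
    rw [LieEquiv.map_lie, hzero, map_smul] at h
    have := congrArg (fun Z => coeffs φ Z γ) h
    simpa only [coeffs_mono_lie, sub_zero, map_zero, zero_smul, map_smul,
      Finsupp.smul_apply] using this
  choose s hs' using hdeg
  have hs0 : s 0 = 0 := by
    refine hr _ fun d => ?_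
    have h := hzero θ.symm d
    have := hs' 0 (coeffs φ (θ.symm (mono φ 0 d)) 0)
    rwa [← h, θ.apply_symm_apply, coeffs_mono_self, map_zero] at this
  have h0 (d : T) : τ s 0 d = coeffs φ (θ (mono φ 0 d)) 0 := by
    simp only [τ, hs0]
    rfl
  have hform (α : A) (d : T) : θ (mono φ α d) = mono φ (s α) (τ s α d) := by
    refine eq_mono_of_weight hr fun e => ?_
    obtain ⟨e', rfl⟩ : ∃ e', coeffs φ (θ (mono φ 0 e')) 0 = e :=
      ⟨coeffs φ (θ.symm (mono φ 0 e)) 0, by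
        rw [← hzero, θ.apply_symm_apply, coeffs_mono_self]⟩
    rw [hs', ← hzero, ← LieEquiv.map_lie, mono_zero_lie_mono, map_smul]
  refine ⟨s, τ s, hform, fun α d => ?_, hs0, ?_, fun e => ?_⟩
  · rw [h0, hs']
  · intro d e h
    refine mono_right_injective (φ := φ) (α := 0) (θ.injective ?_)
    change θ (mono φ 0 d) = θ (mono φ 0 e)
    rw [hform, hform, h]
  · refine ⟨coeffs φ (θ.symm (mono φ 0 e)) 0, ?_⟩
    rw [h0, ← hzero, θ.apply_symm_apply, coeffs_mono_self]

/-- An endomorphism of `T` preserving the kernels of a separating family of functionals is a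
homothety. -/
theorem exists_eq_smul_of_ker_le (hl : ∀ d : T, (∀ α, φ d α = 0) → d = 0) (ρ : T →ₗ[F] T)
    (hρ : ∀ β d, φ d β = 0 → φ (ρ d) β = 0) : ∃ c : F, ∀ d, ρ d = c • d := by
  -- Each functional φ(·, β) is an eigenvector of the transpose of `ρ`; it remains to see that the
  -- eigenvalues agree.
  have heig (β : A) : ∃ c : F, ∀ d, φ (ρ d) β = c * φ d β := by
    by_cases h : ∀ d, φ d β = 0
    · exact ⟨0, fun d => by rw [h, h, mul_zero]⟩
    push Not at h
    obtain ⟨u, hu⟩ := h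
    refine ⟨φ (ρ u) β / φ u β, fun d => ?_⟩
    have := hρ β (d - (φ d β / φ u β) • u) (by simp [hu])
    simp only [map_sub, map_smul, AddMonoidHom.sub_apply, AddMonoidHom.smul_apply, smul_eq_mul,
      sub_eq_zero] at this
    rw [this]
    ring
  choose c hc using heig
  by_cases h : ∀ β d, φ d β = 0
  · exact ⟨0, fun d => by rw [zero_smul]; exact hl _ fun β => h β _⟩
  push Not at h
  obtain ⟨β, u, hu⟩ := h
  refine ⟨c β, fun d => sub_eq_zero.mp (hl _ fun γ => ?_)⟩
  simp only [map_sub, map_smul, AddMonoidHom.sub_apply, AddMonoidHom.smul_apply, smul_eq_mul]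
  rw [hc, ← sub_mul]
  by_contra hne
  -- Additivity in the degree gives a linear relation between two eigenvectors; evaluating it at d
  -- and at `ρ d` forces equal eigenvalues.
  have hsum (d : T) : (c (β + γ) - c β) * φ d β = (c γ - c (β + γ)) * φ d γ := by
    have := hc (β + γ) d
    rw [map_add, map_add, hc, hc] at this
    linear_combination -this
  have h1 := hsum (ρ d)
  rw [hc, hc] at h1
  have h2 : (c γ - c (β + γ)) * ((c γ - c β) * φ d γ) = 0 := by
    linear_combination c β * hsum d - h1
  rcases mul_eq_zero.mp h2 with h2 | h2
  · have h3 := hsum u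
    rw [h2, zero_mul] at h3
    have h4 := (mul_eq_zero.mp h3).resolve_right hu
    exact hne (by rw [show c γ - c β = 0 by linear_combination h2 + h4, zero_mul])
  · exact hne h2

/-- The common factor φ(d, β) lets brackets detect φ(d, β) = 0, a condition that automorphisms then
transport. -/
theorem mono_lie_mono_lie_mono (α β : A) (d e : T) :
    ⁅mono φ α d, ⁅mono φ α d, mono φ β e⁆⁆ = mono φ (α + (α + β))
      (φ d β • ((φ d α + φ d β) • e - (2 * φ e α) • d)) := by
  rw [mono_bracket, mono_bracket]
  congr 1
  simp only [map_add, map_sub, map_smul, AddMonoidHom.sub_apply, AddMonoidHom.smul_apply,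
    smul_eq_mul]
  module

/-- If `T` is not a line, then `(ad t^α ∂)²` vanishes in degree `β` only when `φ(∂, β) = 0`. -/
theorem pairing_eq_zero_of_lie_lie_eq_zero [CharZero F] (hT : ∀ d : T, ∃ e : T, ∀ c : F, e ≠ c • d)
    {α β : A} (hα : ∃ d, φ d α ≠ 0) {d : T}
    (h : ∀ e, ⁅mono φ α d, ⁅mono φ α d, mono φ β e⁆⁆ = 0) : φ d β = 0 := by
  by_contra hb
  have key (e : T) : (φ d α + φ d β) • e = (2 * φ e α) • d := by
    have := mono_eq_zero.mp ((mono_lie_mono_lie_mono α β d e).symm.trans (h e))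
    exact sub_eq_zero.mp ((smul_eq_zero.mp this).resolve_left hb)
  by_cases h0 : φ d α + φ d β = 0
  · obtain ⟨e, he⟩ := hα
    have := key e
    rw [h0, zero_smul] at this
    have hd : d = 0 := (smul_eq_zero.mp this.symm).resolve_left (mul_ne_zero two_ne_zero he)
    exact hb (by rw [hd]; simp)
  · obtain ⟨e, he⟩ := hT d
    refine he ((φ d α + φ d β)⁻¹ * (2 * φ e α)) ?_
    rw [mul_smul, ← key, inv_smul_smul₀ h0]

/-- Every automorphism of a simple `W(A, T, φ)` has the form `t^α ∂ ↦ χ(α) t^(s α) τ(∂)`. -/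
theorem exists_automorphism_form [CharZero F] (hs : LieAlgebra.IsSimple F (GenWitt φ))
    (θ : GenWitt φ ≃ₗ⁅F⁆ GenWitt φ) :
    ∃ (s : A → A) (τ : T →ₗ[F] T) (χ : A → F),
      (∀ α d, θ (mono φ α d) = χ α • mono φ (s α) (τ d)) ∧
      (∀ α d, φ (τ d) (s α) = φ d α) ∧ χ 0 = 1 ∧ s 0 = 0 ∧ Function.Bijective τ := by
  have hl := left_nondegenerate hs
  have hr := right_nondegenerate hs
  obtain ⟨s, τ, hθ, hφ, hs0, hτ⟩ := exists_degree_map hs θ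
  let τe : T ≃ₗ[F] T := LinearEquiv.ofBijective (τ 0) hτ
  have hτe (d : T) : τ 0 (τe.symm d) = d := τe.apply_symm_apply d
  have hsurj (β : A) (e : T) : ∃ d, τ β d = e := by
    obtain ⟨s', τ', hθ', hφ', -, -⟩ := exists_degree_map hs θ.symm
    by_cases he : e = 0
    · exact ⟨0, by rw [he, map_zero]⟩
    have h1 : mono φ (s β) e = mono φ (s (s' (s β))) (τ (s' (s β)) (τ' (s β) e)) := by
      rw [← hθ, ← hθ', θ.apply_symm_apply]
    have h2 := mono_left_injective he h1
    have h3 : s' (s β) = β := by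
      refine sub_eq_zero.mp (hr _ fun d => ?_)
      rw [map_sub, ← hφ, ← h2, hφ, sub_self]
    rw [h3] at h1
    exact ⟨_, (mono_right_injective h1).symm⟩
  have hscalar (α : A) : ∃ c : F, ∀ d, τe.symm (τ α d) = c • d := by
    by_cases hα : ∀ d, φ d α = 0
    · refine ⟨1, fun d => ?_⟩
      rw [hr α hα, one_smul]
      exact τe.symm_apply_apply d
    push Not at hα
    by_cases hT : ∀ d : T, ∃ e : T, ∀ c : F, e ≠ c • d
    · refine exists_eq_smul_of_ker_le hl (τe.symm.toLinearMap ∘ₗ τ α) fun β d hβ => ?_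
      change φ (τe.symm (τ α d)) β = 0
      rw [← hφ, hτe]
      refine pairing_eq_zero_of_lie_lie_eq_zero (α := s α) hT ?_ fun e => ?_
      · obtain ⟨u, hu⟩ := hα
        exact ⟨τ 0 u, by rwa [hφ]⟩
      · obtain ⟨e, rfl⟩ := hsurj β e
        rw [← hθ, ← hθ, ← LieEquiv.map_lie, ← LieEquiv.map_lie, mono_lie_mono_lie_mono, hβ,
          zero_smul, mono_zero, map_zero]
    · push Not at hT
      obtain ⟨u, hu⟩ := hT
      obtain ⟨c, hc⟩ := hu (τe.symm (τ α u))
      refine ⟨c, fun d => ?_⟩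
      obtain ⟨b, rfl⟩ := hu d
      rw [map_smul, map_smul, hc, smul_comm]
  choose c hc using hscalar
  have hcτ (α : A) (d : T) : τ α d = c α • τ 0 d := by
    rw [← hτe (τ α d), hc, map_smul]
  refine ⟨s, τ 0, c, fun α d => ?_, hφ, ?_, hs0, hτ⟩
  · rw [hθ, hcτ, mono_smul]
  · obtain ⟨d, hd⟩ := exists_ne_zero hs
    refine smul_left_injective F hd ?_
    simp only [← hc, one_smul]
    exact τe.symm_apply_apply d

/-! ### Isometries of the pairing -/

theorem injective_of_pairing_eq (hr : ∀ α : A, (∀ d, φ d α = 0) → α = 0) {s : A → A}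
    {τ : T → T} (h : ∀ α d, φ (τ d) (s α) = φ d α) : Function.Injective s := by
  intro α β hαβ
  refine sub_eq_zero.mp (hr _ fun d => ?_)
  rw [map_sub, ← h, hαβ, h, sub_self]

theorem map_add_of_pairing_eq (hr : ∀ α : A, (∀ d, φ d α = 0) → α = 0) {s : A → A}
    {τ : T → T} (hτ : Function.Surjective τ) (h : ∀ α d, φ (τ d) (s α) = φ d α) (α β : A) :
    s (α + β) = s α + s β := by
  refine sub_eq_zero.mp (hr _ fun d => ?_)
  obtain ⟨d, rfl⟩ := hτ d
  rw [map_sub, map_add, h, h, h, map_add, sub_self]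

theorem mono_lie_mono_of_pairing_eq (hr : ∀ α : A, (∀ d, φ d α = 0) → α = 0) {s : A → A}
    {τ : T →ₗ[F] T} (hτ : Function.Surjective τ) (h : ∀ α d, φ (τ d) (s α) = φ d α)
    (α β : A) (d e : T) :
    ⁅mono φ (s α) (τ d), mono φ (s β) (τ e)⁆ =
      mono φ (s (α + β)) (τ (φ d β • e - φ e α • d)) := by
  rw [mono_bracket, h, h, map_add_of_pairing_eq hr hτ h, map_sub, map_smul, map_smul]

theorem coeffs_sum_smul_mono {s : A → A} (hs : Function.Injective s) (S : Finset A) (c : A → F)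
    (d : T) {α : A} (hα : α ∈ S) :
    coeffs φ (∑ γ ∈ S, c γ • mono φ (s γ) d) (s α) = c α • d := by
  rw [map_sum, Finsupp.finsetSum_apply, Finset.sum_eq_single_of_mem α hα]
  · rw [map_smul, Finsupp.smul_apply, coeffs_mono_self]
  · intro γ _ hγ
    rw [map_smul, Finsupp.smul_apply, coeffs_mono_of_ne (hs.ne hγ.symm), smul_zero]

theorem exists_of_coeffs_sum_smul_mono_ne_zero {s : A → A} {S : Finset A} {c : A → F}
    {d : T} {γ : A} (h : coeffs φ (∑ α ∈ S, c α • mono φ (s α) d) γ ≠ 0) : ∃ α ∈ S, s α = γ := by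
  contrapose! h
  rw [map_sum, Finsupp.finsetSum_apply]
  refine Finset.sum_eq_zero fun α hα => ?_
  rw [map_smul, Finsupp.smul_apply, coeffs_mono_of_ne (h α hα).symm, smul_zero]

/-- Some `∂ ∈ T` takes distinct values at the elements of a given finite set. -/
theorem exists_injOn_pairing [CharZero F] (hr : ∀ α : A, (∀ d, φ d α = 0) → α = 0)
    (S : Finset A) : ∃ d : T, Set.InjOn (φ d) S := by
  let f (p : {p : S × S // (p.1 : A) ≠ p.2}) : Module.Dual F T :=
    { toFun := fun d => φ d (p.1.1 - p.1.2)
      map_add' := fun d e => by simp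
      map_smul' := fun c d => by simp [mul_sub] }
  -- Finitely many nonzero functionals over an infinite field have a common point of nonvanishing.
  obtain ⟨d, hd⟩ := Module.Dual.exists_forall_ne_zero_of_forall_exists f fun p => by
    by_contra! h
    exact p.2 (sub_eq_zero.mp (hr _ h))
  refine ⟨d, fun α hα β hβ h => ?_⟩
  by_contra hne
  refine hd ⟨(⟨α, hα⟩, ⟨β, hβ⟩), hne⟩ ?_
  change φ d (α - β) = 0
  rw [map_sub, h, sub_self]

/-! ### Local automorphisms -/

theorem exists_mono_zero_of_local [CharZero F] (hs : LieAlgebra.IsSimple F (GenWitt φ))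
    {Φ : GenWitt φ →ₗ[F] GenWitt φ} (hlocal : IsLocalLieAutomorphism Φ)
    (hinv : Function.Bijective Φ) :
    ∃ τ : T →ₗ[F] T, Function.Bijective τ ∧ ∀ d, Φ (mono φ 0 d) = mono φ 0 (τ d) := by
  let τ : T →ₗ[F] T := Finsupp.lapply 0 ∘ₗ (coeffs φ).toLinearMap ∘ₗ Φ ∘ₗ monoHom φ 0
  have hτ (d : T) : Φ (mono φ 0 d) = mono φ 0 (τ d) := by
    obtain ⟨θ, hθ⟩ := hlocal (mono φ 0 d)
    obtain ⟨s, τ', χ, h, -, h0, hs0, -⟩ := exists_automorphism_form hs θ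
    have h1 : Φ (mono φ 0 d) = mono φ 0 (τ' d) := by rw [hθ, h, h0, hs0, one_smul]
    change Φ (mono φ 0 d) = mono φ 0 (coeffs φ (Φ (mono φ 0 d)) 0)
    rw [h1, coeffs_mono_self]
  refine ⟨τ, ⟨fun d e h => ?_, fun e => ?_⟩, hτ⟩
  · refine mono_right_injective (φ := φ) (α := 0) (hinv.1 ?_)
    rw [hτ, hτ, h]
  · obtain ⟨X, hX⟩ := hinv.2 (mono φ 0 e)
    obtain ⟨θ, hθ⟩ := hlocal X
    obtain ⟨s, τ', χ, h, -, h0, hs0, -⟩ := exists_automorphism_form hs θ.symm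
    have h1 : X = mono φ 0 (τ' e) := by
      rw [← θ.symm_apply_apply X, ← hθ, hX, h, h0, hs0, one_smul]
    refine ⟨τ' e, mono_right_injective (φ := φ) (α := 0) ?_⟩
    rw [← hτ, ← h1, hX]

/-- On homogeneous elements a bijective local automorphism looks like an automorphism. -/
theorem exists_form_of_local [CharZero F] (hs : LieAlgebra.IsSimple F (GenWitt φ))
    {Φ : GenWitt φ →ₗ[F] GenWitt φ} (hlocal : IsLocalLieAutomorphism Φ)
    (hinv : Function.Bijective Φ) :
    ∃ (s : A → A) (τ : T →ₗ[F] T) (c : A → F),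
      (∀ α d, Φ (mono φ α d) = c α • mono φ (s α) (τ d)) ∧
      (∀ α d, φ (τ d) (s α) = φ d α) ∧ c 0 = 1 ∧ s 0 = 0 ∧ Function.Bijective τ := by
  have hr := right_nondegenerate hs
  obtain ⟨τ, hτ, hΦ0⟩ := exists_mono_zero_of_local hs hlocal hinv
  have main (α : A) (e : T) (he : e ≠ 0) : ∃ γ, (∀ d, φ (τ d) γ = φ d α) ∧
      ∃ c : F, Φ (mono φ α e) = c • mono φ γ (τ e) := by
    by_cases hα : α = 0
    · subst hα
      exact ⟨0, fun d => by simp, 1, by rw [hΦ0, one_smul]⟩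
    obtain ⟨θ, hθ⟩ := hlocal (mono φ α e)
    obtain ⟨s, τ₁, χ, h, hφ, h0, hs0, -⟩ := exists_automorphism_form hs θ
    have h1 : Φ (mono φ α e) = mono φ (s α) (χ α • τ₁ e) := by rw [hθ, h, mono_smul]
    have hne : χ α • τ₁ e ≠ 0 := fun h' => by
      rw [h', mono_zero] at h1
      exact he (mono_eq_zero.mp ((map_eq_zero_iff Φ hinv.1).mp h1))
    have hs_ne : s α ≠ 0 := fun h' => hα (injective_of_pairing_eq hr hφ (h'.trans hs0.symm))
    -- The degree 0 part of the test vector t^0 d + t^α e identifies τ₂ d with τ d. For d = e the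
    -- same τ₂ e also occurs in degree s α, so that component is a multiple of τ e.
    have test (d : T) : φ (τ d) (s α) = φ d α ∧
        ∃ c : F, d = e → χ α • τ₁ e = c • τ d := by
      obtain ⟨θ₂, hθ₂⟩ := hlocal (mono φ 0 d + mono φ α e)
      obtain ⟨s₂, τ₂, χ₂, h₂, hφ₂, h0₂, hs0₂, -⟩ := exists_automorphism_form hs θ₂
      have hs_ne₂ : s₂ α ≠ 0 := fun h' =>
        hα (injective_of_pairing_eq hr hφ₂ (h'.trans hs0₂.symm))
      rw [map_add, map_add, h₂, h₂, hΦ0, h1, h0₂, hs0₂, one_smul, ← mono_smul] at hθ₂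
      have hd := congrArg (fun Z => coeffs φ Z 0) hθ₂
      simp only [map_add, Finsupp.add_apply, coeffs_mono_self, coeffs_mono_of_ne hs_ne.symm,
        coeffs_mono_of_ne hs_ne₂.symm, add_zero] at hd
      have he' := congrArg (fun Z => coeffs φ Z (s α)) hθ₂
      simp only [map_add, Finsupp.add_apply, coeffs_mono_self, coeffs_mono_of_ne hs_ne,
        zero_add] at he'
      have hss : s α = s₂ α := by
        by_contra hne'
        rw [coeffs_mono_of_ne hne'] at he'
        exact hne he'
      rw [hss, coeffs_mono_self] at he'
      exact ⟨by rw [hd, hss, hφ₂], χ₂ α, fun hde => by rw [he', hd, hde]⟩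
    refine ⟨s α, fun d => (test d).1, ?_⟩
    obtain ⟨-, c, h'⟩ := test e
    exact ⟨c, by rw [h1, h' rfl, mono_smul]⟩
  have hdeg (α : A) : ∃ γ, ∀ d, φ (τ d) γ = φ d α := by
    obtain ⟨e, he⟩ := exists_ne_zero hs
    obtain ⟨γ, hγ, -⟩ := main α e he
    exact ⟨γ, hγ⟩
  choose s hφ using hdeg
  have hform (α : A) (e : T) : ∃ c : F, Φ (mono φ α e) = c • mono φ (s α) (τ e) := by
    by_cases he : e = 0
    · exact ⟨0, by rw [he, mono_zero, map_zero, zero_smul]⟩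
    obtain ⟨γ, hγ, h⟩ := main α e he
    obtain rfl : γ = s α := by
      refine sub_eq_zero.mp (hr _ fun d => ?_)
      obtain ⟨d, rfl⟩ := hτ.2 d
      rw [map_sub, hγ, hφ, sub_self]
    exact h
  -- So far the scalar may depend on the vector; a linear map for which every vector is an
  -- eigenvector is a homothety.
  have hscalar (α : A) : ∃ c : F, ∀ d, Φ (mono φ α d) = c • mono φ (s α) (τ d) := by
    let τe : T ≃ₗ[F] T := LinearEquiv.ofBijective τ hτ
    let ρ : T →ₗ[F] T := τe.symm.toLinearMap ∘ₗ Finsupp.lapply (s α) ∘ₗ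
      (coeffs φ).toLinearMap ∘ₗ Φ ∘ₗ monoHom φ α
    have hρ {d : T} {c : F} (h : Φ (mono φ α d) = c • mono φ (s α) (τ d)) : ρ d = c • d := by
      change τe.symm (coeffs φ (Φ (mono φ α d)) (s α)) = c • d
      rw [h, map_smul, Finsupp.smul_apply, coeffs_mono_self, map_smul]
      exact congrArg (c • ·) (τe.symm_apply_apply d)
    obtain ⟨a, ha⟩ := LinearMap.exists_eq_smul_id_of_forall_notLinearIndependent (f := ρ)
      fun d hd => by
        obtain ⟨c, hc⟩ := hform α d
        have := (LinearIndependent.pair_iff.mp hd c (-1) (by rw [hρ hc]; module)).2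
        exact one_ne_zero (neg_eq_zero.mp this)
    refine ⟨a, fun d => ?_⟩
    obtain ⟨c, hc⟩ := hform α d
    have hca : c • d = a • d := by
      rw [← hρ hc, ha]
      rfl
    rw [hc, ← mono_smul, ← mono_smul, ← map_smul, ← map_smul, hca]
  choose c hc using hscalar
  have hs0 : s 0 = 0 := by
    refine hr _ fun d => ?_
    obtain ⟨d, rfl⟩ := hτ.2 d
    rw [hφ, map_zero]
  refine ⟨s, τ, c, hc, hφ, ?_, hs0, hτ⟩
  obtain ⟨d, hd⟩ := exists_ne_zero hs
  have h := hc 0 d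
  rw [hΦ0, hs0, ← mono_smul] at h
  refine smul_left_injective F ((map_ne_zero_iff τ hτ.1).mpr hd) ?_
  simp only [one_smul]
  exact (mono_right_injective h).symm

/-- Bijective local automorphisms agree on finitely many degrees with an automorphism, as far as
degrees and scalars are concerned. -/
theorem exists_automorphism_eq_on [CharZero F] (hs : LieAlgebra.IsSimple F (GenWitt φ))
    {Φ : GenWitt φ →ₗ[F] GenWitt φ} (hlocal : IsLocalLieAutomorphism Φ)
    {s : A → A} {τ : T →ₗ[F] T} {c : A → F}
    (hΦ : ∀ α d, Φ (mono φ α d) = c α • mono φ (s α) (τ d))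
    (hφ : ∀ α d, φ (τ d) (s α) = φ d α) (hc0 : c 0 = 1) (hs0 : s 0 = 0)
    (hinv : Function.Bijective Φ) (hτ : Function.Injective τ) (S : Finset A) (hS : 0 ∈ S)
    (hS' : ∃ α ∈ S, α ≠ 0) :
    ∃ (θ : GenWitt φ ≃ₗ⁅F⁆ GenWitt φ) (s' : A → A) (τ' : T →ₗ[F] T),
      (∀ α ∈ S, ∀ d, θ (mono φ α d) = c α • mono φ (s' α) (τ' d)) ∧
      (∀ α d, φ (τ' d) (s' α) = φ d α) ∧ Function.Bijective τ' := by
  have hr := right_nondegenerate hs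
  obtain ⟨d, hd⟩ := exists_injOn_pairing hr S
  have hd0 : d ≠ 0 := by
    rintro rfl
    obtain ⟨α, hα, hne⟩ := hS'
    exact hne (hd hα hS (by simp))
  have hc (α : A) : c α ≠ 0 := fun h => by
    have := hΦ α d
    rw [h, zero_smul] at this
    exact hd0 (mono_eq_zero.mp ((map_eq_zero_iff Φ hinv.1).mp this))
  have hτd : τ d ≠ 0 := (map_ne_zero_iff τ hτ).mpr hd0
  obtain ⟨θ, hθ⟩ := hlocal (∑ γ ∈ S, mono φ γ d)
  obtain ⟨s', τ', χ, h', hφ', hχ0, hs0', hτ'⟩ := exists_automorphism_form hs θ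
  have hinj := injective_of_pairing_eq hr hφ
  have hinj' := injective_of_pairing_eq hr hφ'
  simp only [map_sum, hΦ, h'] at hθ
  have hττ : τ d = τ' d := by
    have : coeffs φ _ (s 0) = coeffs φ _ (s' 0) :=
      (congrArg (fun Z => coeffs φ Z (s 0)) hθ).trans (by rw [hs0, hs0'])
    rw [coeffs_sum_smul_mono hinj S c _ hS, coeffs_sum_smul_mono hinj' S χ _ hS, hc0, hχ0,
      one_smul, one_smul] at this
    exact this
  have hχ (γ : A) (hγ : γ ∈ S) : c γ = χ γ := by
    have h1 := congrArg (fun Z => coeffs φ Z (s γ)) hθ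
    simp only [coeffs_sum_smul_mono hinj S c _ hγ] at h1
    obtain ⟨γ', hγ', hss⟩ := exists_of_coeffs_sum_smul_mono_ne_zero
      (h1 ▸ smul_ne_zero (hc γ) hτd)
    -- Equal degrees s γ = s' γ' and τ d = τ' d give φ(d, γ) = φ(d, γ'), and d separates S.
    obtain rfl : γ = γ' := hd hγ hγ' (by rw [← hφ γ, ← hφ' γ', hττ, hss])
    rw [← hss, coeffs_sum_smul_mono hinj' S χ _ hγ, ← hττ] at h1
    exact smul_left_injective F hτd h1
  exact ⟨θ, s', τ', fun α hα d => by rw [h', hχ α hα], hφ', hτ'⟩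

theorem map_lie_of_local [CharZero F] (hs : LieAlgebra.IsSimple F (GenWitt φ))
    {Φ : GenWitt φ →ₗ[F] GenWitt φ} (hlocal : IsLocalLieAutomorphism Φ)
    (hinv : Function.Bijective Φ) (X Y : GenWitt φ) : Φ ⁅X, Y⁆ = ⁅Φ X, Φ Y⁆ := by
  classical
  have hr := right_nondegenerate hs
  obtain ⟨s, τ, c, hΦ, hφ, hc0, hs0, hτ⟩ := exists_form_of_local hs hlocal hinv
  -- Multiplicativity is claimed only against the bracket's coefficient vector, so vanishing
  -- brackets impose nothing.
  have key (α β : A) (d e : T) : c (α + β) • (φ d β • e - φ e α • d) =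
      (c α * c β) • (φ d β • e - φ e α • d) := by
    by_cases h0 : α = 0 ∧ β = 0
    · rw [h0.1, h0.2, add_zero, hc0, one_mul]
    obtain ⟨θ, s', τ', h', hφ', hτ'⟩ := exists_automorphism_eq_on hs hlocal hΦ hφ hc0 hs0 hinv hτ.1
      {0, α, β, α + β} (by simp) (by
        by_cases hα : α = 0
        · exact ⟨β, by simp, fun hβ => h0 ⟨hα, hβ⟩⟩
        · exact ⟨α, by simp, hα⟩)
    have h := LieEquiv.map_lie θ (mono φ α d) (mono φ β e)
    rw [mono_bracket, h' _ (by simp), h' _ (by simp), h' _ (by simp), smul_lie, lie_smul, smul_smul,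
      mono_lie_mono_of_pairing_eq hr hτ'.2 hφ', ← mono_smul, ← mono_smul, ← map_smul,
      ← map_smul] at h
    exact hτ'.1 (mono_right_injective h)
  induction X using mono_induction with
  | zero => simp
  | add X X' h h' => rw [add_lie, map_add, map_add, add_lie, h, h']
  | mono α d =>
    induction Y using mono_induction with
    | zero => simp
    | add Y Y' h h' => rw [lie_add, map_add, map_add, lie_add, h, h']
    | mono β e =>
      rw [mono_bracket, hΦ, hΦ, hΦ, smul_lie, lie_smul, smul_smul,
        mono_lie_mono_of_pairing_eq hr hτ.2 hφ, ← mono_smul, ← mono_smul, ← map_smul, ← map_smul,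
        key]

end GenWitt

end
/-- Every invertible local automorphism of a simple generalized Witt algebra `W(A, T, φ)` over a
field of characteristic `0` is an automorphism. -/
theorem mainTheorem2 {F A T : Type*} [Field F] [CharZero F] [AddCommGroup A] [AddCommGroup T]
    [Module F T] (φ : T →ₗ[F] A →+ F) (hsimple : LieAlgebra.IsSimple F (GenWitt φ))
    (Φ : GenWitt φ →ₗ[F] GenWitt φ) (hlocal : IsLocalLieAutomorphism Φ)
    (hinv : Function.Bijective Φ) :
    ∃ θ : GenWitt φ ≃ₗ⁅F⁆ GenWitt φ, ∀ x : GenWitt φ, θ x = Φ x :=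
  ⟨{ LinearEquiv.ofBijective Φ hinv with
      map_lie' := fun {X Y} => GenWitt.map_lie_of_local hsimple hlocal hinv X Y }, fun _ => rfl⟩
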